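/- For $N\ge 0$ let $T$ be the finite dyadic tree of depth $N$, whose nodes are the dyadic subintervals of $[0,1]$ of length $2^{-k}$, $0\le k\le N$, and let $T^2=T\times T$ be the bi-tree, whose nodes $\alpha$ are identified with the dyadic rectangles $R_\alpha\subset[0,1]^2$ that are products of two such intervals. The boundary $\partial T^2$ is the set of the $4^N$ nodes $\omega$ for which $R_\omega$ is a dyadic square of side $2^{-N}$. A measure $\mu$ on $\partial T^2$ is a function $\mu:\partial T^2\to[0,\infty)$; we write $\mu(E)=\sum_{\omega\in E}\mu(\omega)$ for $E\subset\partial T^2$, $\mu(R_\alpha)=\sum_{\omega\in\partial T^2,\,R_\omega\subset R_\alpha}\mu(\omega)$ for $\alpha\in T^2$, and $\mu|E$ for the restriction of $\mu$ to $E$ (equal to $\mu$ on $E$ and to $0$ off $E$). Put $$\mathcal E[\mu]=\sum_{\alpha\in T^2}\mu(R_\alpha)^2,\qquad \mathcal E_E[\mu]=\sum_{\alpha\in T^2:\ R_\alpha\subset U_E}\mu(R_\alpha)^2,\qquad U_E=\bigcup_{\omega\in E}R_\omega .$$ For $C\ge 0$ consider the conditions 1. (Carleson, with constant $C$) $\mathcal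 E_E[\mu]\le C\mu(E)$ for all $E\subset\partial T^2$; 2. (restricted energy condition, with constant $C$) $\mathcal E[\mu|E]\le C\mu(E)$ for all $E\subset\partial T^2$; 3. (hereditary Carleson, with constant $C$) for every $E\subset\partial T^2$ the measure $\mu|E$ satisfies condition 1 with constant $C$. **Theorem 1.2.** These three conditions are equivalent, with constants comparable uniformly in the depth: there is an absolute constant $A>0$ such that for all $N\ge0$, all measures $\mu$ on $\partial T^2$ and all $C\ge0$, if $\mu$ satisfies one of the three conditions with constant $C$, then it satisfies the other two with constant $AC$. -/

import Mathlib

open scoped NNReal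

namespace BiTree

noncomputable section

/-- The finite dyadic tree `T` of depth `N`: the node `⟨k, j⟩`, with `k ≤ N` and `j < 2 ^ k`, stands
for the dyadic subinterval `[j / 2 ^ k, (j + 1) / 2 ^ k]` of `[0, 1]`. -/
abbrev Tree (N : ℕ) : Type := Σ k : Fin (N + 1), Fin (2 ^ (k : ℕ))

/-- The dyadic interval of a node of the tree. -/
def interval {N : ℕ} (a : Tree N) : Set ℝ :=
  Set.Icc ((a.2 : ℝ) / 2 ^ (a.1 : ℕ)) (((a.2 : ℝ) + 1) / 2 ^ (a.1 : ℕ))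

/-- The nodes of the bi-tree `T² = T × T` of depth `N`. -/
abbrev Node (N : ℕ) : Type := Tree N × Tree N

/-- The dyadic rectangle `R_α ⊆ [0, 1]²` of a node `α` of the bi-tree. -/
def rect {N : ℕ} (α : Node N) : Set (ℝ × ℝ) := interval α.1 ×ˢ interval α.2

/-- The boundary `∂T² = ∂T × ∂T`, where `∂T` is the set of the `2 ^ N` nodes of level `N`. -/
abbrev Boundary (N : ℕ) : Type := Fin (2 ^ N) × Fin (2 ^ N)

/-- A boundary point, as a node of the bi-tree. -/
def leaf {N : ℕ} (ω : Boundary N) : Node N := (⟨Fin.last N, ω.1⟩, ⟨Fin.last N, ω.2⟩)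

/-- The set `U_E`, the union of the squares `R_ω` with `ω ∈ E`. -/
def union {N : ℕ} (E : Finset (Boundary N)) : Set (ℝ × ℝ) := ⋃ ω ∈ E, rect (leaf ω)

open Classical in
/-- The collection `R_E` of the dyadic rectangles (nodes of the bi-tree) contained in `U_E`. -/
def rectsIn {N : ℕ} (E : Finset (Boundary N)) : Finset (Node N) :=
  {α | rect α ⊆ union E}

/-! A measure on `∂T²` is given by its (finite, non-negative) masses `μ ω`. -/

/-- `μ(E)`, for a set `E` of boundary points. -/
def mass {N : ℕ} (μ : Boundary N → ℝ≥0) (E : Finset (Boundary N)) : ℝ := ∑ ω ∈ E, (μ ω : ℝ)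

open Classical in
/-- `μ(R_α)`, the total mass of the boundary squares contained in `R_α`. -/
def rectMass {N : ℕ} (μ : Boundary N → ℝ≥0) (α : Node N) : ℝ :=
  mass μ {ω | rect (leaf ω) ⊆ rect α}

/-- The restriction `μ|E`. -/
def restrict {N : ℕ} (μ : Boundary N → ℝ≥0) (E : Finset (Boundary N)) : Boundary N → ℝ≥0 :=
  fun ω => if ω ∈ E then μ ω else 0

/-- The energy `𝓔[μ]`, the sum of `μ(R_α)²` over all nodes of the bi-tree. -/
def energy {N : ℕ} (μ : Boundary N → ℝ≥0) : ℝ := ∑ α : Node N, rectMass μ α ^ 2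

/-- The local energy `𝓔_E[μ]`, the sum of `μ(R)²` over the dyadic rectangles `R ⊆ U_E`. -/
def localEnergy {N : ℕ} (E : Finset (Boundary N)) (μ : Boundary N → ℝ≥0) : ℝ :=
  ∑ α ∈ rectsIn E, rectMass μ α ^ 2

/-- `μ` is a `C`-Carleson measure: `𝓔_E[μ] ≤ C μ(E)` for all `E ⊆ ∂T²`. -/
def IsCarleson {N : ℕ} (C : ℝ) (μ : Boundary N → ℝ≥0) : Prop :=
  ∀ E : Finset (Boundary N), localEnergy E μ ≤ C * mass μ E

/-- The restricted energy condition with constant `C`: `𝓔[μ|E] ≤ C μ(E)` for all `E ⊆ ∂T²`. -/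
def IsREC {N : ℕ} (C : ℝ) (μ : Boundary N → ℝ≥0) : Prop :=
  ∀ E : Finset (Boundary N), energy (restrict μ E) ≤ C * mass μ E

/-- `μ` is hereditary Carleson with constant `C`: every restriction `μ|E` is `C`-Carleson. -/
def IsHereditaryCarleson {N : ℕ} (C : ℝ) (μ : Boundary N → ℝ≥0) : Prop :=
  ∀ E : Finset (Boundary N), IsCarleson C (restrict μ E)

end

end BiTree

/-! The restricted energy condition passes to restrictions, and a rectangle inside `U_E` sees only
the mass in `E`; so it gives the other two conditions with the same constant. Hereditary Carleson
contains Carleson, so only Carleson ⇒ restricted energy remains.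

Let `a` be the best restricted energy constant, attained at `E`, and put `ν = μ|E`. Split the nodes
by whether the potential of `ν` exceeds `δ`, a small multiple of `a`. Nodes of high potential lie in
`U_F`, where `F` is the set of boundary points of high potential; they cost at most `C μ(F)`, and
Cauchy-Schwarz with the constant `a` gives `μ(F) ≤ (a/δ)² μ(E)`. Nodes of low potential carry at
most half of the energy `a μ(E)`, so `a` is at most a multiple of `C`.

The last bound is the heart (`sum_lowMass_sq_le`). With `f` the rectangle mass cut off to low
potential, `∑ f² = ∫ potential f dν`. The potential of `f` is at most `3κ` plus twice that of
`majorant`, a product of two one-variable sums of `f` over `potential f + κ` (`grid_majorization`).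
A one-variable Bellman argument (`tree_embedding`) shows that `majorant` is small in `ℓ²`. -/

namespace BiTree

/-! ### Sums over ancestors in one tree. -/

/-- The Hardy operator on the dyadic tree: the sum of `F` over the ancestors of the `j`-th node of
level `k`, that node included. -/
def hardy (F : ℕ → ℕ → ℝ) (k j : ℕ) : ℝ := ∑ i ∈ Finset.range (k + 1), F i (j / 2 ^ (k - i))

lemma hardy_zero (F : ℕ → ℕ → ℝ) (j : ℕ) : hardy F 0 j = F 0 j := by simp [hardy]

lemma hardy_succ (F : ℕ → ℕ → ℝ) (k j : ℕ) :
    hardy F (k + 1) j = hardy F k (j / 2) + F (k + 1) j := by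
  unfold hardy
  rw [Finset.sum_range_succ _ (k + 1)]
  congr 1
  · refine Finset.sum_congr rfl fun i hi => ?_
    have : k + 1 - i = (k - i) + 1 := by have := Finset.mem_range.1 hi; omega
    rw [this, pow_succ', Nat.div_div_eq_div_mul]
  · simp

lemma hardy_nonneg {F : ℕ → ℕ → ℝ} (hF : ∀ k j, 0 ≤ F k j) (k j : ℕ) : 0 ≤ hardy F k j :=
  Finset.sum_nonneg fun _ _ => hF _ _

lemma hardy_mono {F G : ℕ → ℕ → ℝ} (h : ∀ k j, F k j ≤ G k j) (k j : ℕ) :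
    hardy F k j ≤ hardy G k j :=
  Finset.sum_le_sum fun _ _ => h _ _

/-- Along the branch of a leaf `x`, the Hardy operator is a partial sum. -/
lemma hardy_branch (F : ℕ → ℕ → ℝ) {N k : ℕ} (hk : k ≤ N) (x : ℕ) :
    hardy F k (x / 2 ^ (N - k)) = ∑ i ∈ Finset.range (k + 1), F i (x / 2 ^ (N - i)) := by
  refine Finset.sum_congr rfl fun i hi => ?_
  have : N - i = (N - k) + (k - i) := by have := Finset.mem_range.1 hi; omega
  rw [Nat.div_div_eq_div_mul, ← pow_add, this]

lemma hardy_branch_le {F : ℕ → ℕ → ℝ} (hF : ∀ k j, 0 ≤ F k j) {N k : ℕ} (hk : k ≤ N) (x : ℕ) :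
    hardy F k (x / 2 ^ (N - k)) ≤ hardy F N x := by
  have h := hardy_branch F (le_refl N) x
  rw [Nat.sub_self, pow_zero, Nat.div_one] at h
  rw [hardy_branch F hk, h]
  exact Finset.sum_le_sum_of_subset_of_nonneg (Finset.range_mono (by omega)) fun _ _ _ => hF _ _

lemma sum_tree (N : ℕ) (h : ℕ → ℕ → ℝ) :
    ∑ a : Tree N, h a.1 a.2 = ∑ k ∈ Finset.range (N + 1), ∑ j ∈ Finset.range (2 ^ k), h k j := by
  rw [Fintype.sum_sigma, ← Fin.sum_univ_eq_sum_range (fun k => ∑ j ∈ Finset.range (2 ^ k), h k j)]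
  exact Finset.sum_congr rfl fun k _ => Fin.sum_univ_eq_sum_range (fun j => h k j) _

lemma sum_range_two_mul (h : ℕ → ℝ) (n : ℕ) :
    ∑ j ∈ Finset.range (2 * n), h j = ∑ j ∈ Finset.range n, (h (2 * j) + h (2 * j + 1)) := by
  induction n with
  | zero => simp
  | succ n ih =>
    rw [show 2 * (n + 1) = 2 * n + 1 + 1 by ring, Finset.sum_range_succ, Finset.sum_range_succ, ih,
      Finset.sum_range_succ, add_assoc]

/-! ### Weighted one-parameter embedding. -/

/-- The Bellman function in the proof of the weighted one-parameter embedding. -/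
noncomputable def bellman (δ κ t : ℝ) : ℝ := 1 / (t + κ) + 1 / κ * max 0 (1 - t / δ)

section Bellman

variable {δ κ : ℝ}

lemma bellman_nonneg (hκ : 0 < κ) {t : ℝ} (ht : 0 ≤ t) : 0 ≤ bellman δ κ t := by
  unfold bellman; positivity

lemma bellman_le (hδ : 0 < δ) (hκ : 0 < κ) {t : ℝ} (ht : 0 ≤ t) : bellman δ κ t ≤ 2 / κ := by
  have h1 : 1 / (t + κ) ≤ 1 / κ := one_div_le_one_div_of_le hκ (by linarith)
  have h2 : max 0 (1 - t / δ) ≤ 1 := max_le zero_le_one (by have : 0 ≤ t / δ := by positivity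
                                                            linarith)
  have h3 : 1 / κ * max 0 (1 - t / δ) ≤ 1 / κ * 1 := by gcongr
  unfold bellman
  calc _ ≤ 1 / κ + 1 / κ * 1 := add_le_add h1 h3
    _ = 2 / κ := by ring

lemma inv_shift_drop (hκ : 0 < κ) {t G : ℝ} (ht : 0 ≤ t) (hG : 0 ≤ G) :
    G / (t + G + κ) ^ 2 + 1 / (t + G + κ) ≤ 1 / (t + κ) := by
  have h1 : 0 < t + κ := by linarith
  have h2 : 0 < t + G + κ := by linarith
  rw [div_add_div _ _ (by positivity) (by positivity), div_le_div_iff₀ (by positivity) h1]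
  nlinarith [mul_nonneg (mul_nonneg hG hG) h2.le]

lemma bellman_drop (hδ : 0 < δ) (hκ : 0 < κ) {t G : ℝ} (ht : 0 ≤ t) (hG : 0 ≤ G) :
    G / (t + G + κ) ^ 2 + bellman δ κ (t + G) ≤ bellman δ κ t := by
  have h := inv_shift_drop hκ ht hG
  have h2 : max 0 (1 - (t + G) / δ) ≤ max 0 (1 - t / δ) := by
    gcongr; linarith
  have h3 : 1 / κ * max 0 (1 - (t + G) / δ) ≤ 1 / κ * max 0 (1 - t / δ) := by gcongr
  unfold bellman
  linarith

/-- Below `δ` the truncated linear term has slope `-1/(δκ)`; this extra decrease pays for the cross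
term when `F` does not vanish. -/
lemma bellman_drop_strict (hδ : 0 < δ) (hκ : 0 < κ) {t G : ℝ} (ht : 0 ≤ t) (hG : 0 ≤ G)
    (htG : t + G ≤ δ) :
    G / (t + G + κ) ^ 2 + bellman δ κ (t + G) + G / (δ * κ) ≤ bellman δ κ t := by
  have h := inv_shift_drop hκ ht hG
  have h1 : (t + G) / δ ≤ 1 := (div_le_one hδ).2 htG
  have h2 : t / δ ≤ 1 := (div_le_one hδ).2 (by linarith)
  unfold bellman
  rw [max_eq_right (by linarith), max_eq_right (by linarith)]
  have : 1 / κ * (1 - (t + G) / δ) + G / (δ * κ) = 1 / κ * (1 - t / δ) := by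
    field_simp; ring
  linarith

/-- The concavity inequality of the Bellman function at one node. -/
lemma bellman_step (hδ : 0 < δ) (hκ : 0 < κ) {s t F G : ℝ} (ht : 0 ≤ t) (hG : 0 ≤ G)
    (hF : F ≠ 0 → t + G ≤ δ) :
    ((s + F) * G / (t + G + κ)) ^ 2 + G * (s + F) ^ 2 * bellman δ κ (t + G) ≤
      G * s ^ 2 * bellman δ κ t + 6 * δ / κ * F ^ 2 := by
  set P := G / (t + G + κ) ^ 2 + bellman δ κ (t + G) with hP
  have hP0 : 0 ≤ P := add_nonneg (by positivity) (bellman_nonneg hκ (by linarith))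
  have hl : ((s + F) * G / (t + G + κ)) ^ 2 + G * (s + F) ^ 2 * bellman δ κ (t + G) =
      G * (s + F) ^ 2 * P := by rw [hP, div_pow, mul_pow]; ring
  rw [hl]
  by_cases hF0 : F = 0
  · have := bellman_drop hδ hκ ht hG
    subst hF0
    simp only [add_zero, ne_eq, OfNat.ofNat_ne_zero, not_false_eq_true, zero_pow, mul_zero]
    gcongr
  have htG := hF hF0
  have hd := bellman_drop_strict hδ hκ ht hG htG
  have hU := bellman_le (δ := δ) hδ hκ ht
  rcases hG.eq_or_lt with hG0 | hGpos
  · rw [← hG0]; simp only [zero_mul, zero_add]; positivity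
  have hPU : P ≤ 2 / κ := by
    have : 0 ≤ G / (δ * κ) := by positivity
    linarith
  -- Young's inequality with parameter `G / (2 δ)`
  have hY : G * (s + F) ^ 2 ≤ G * s ^ 2 * (1 + G / (2 * δ)) + (G + 2 * δ) * F ^ 2 := by
    have : 0 ≤ (G * s - 2 * δ * F) ^ 2 / (2 * δ) := by positivity
    have e : G * s ^ 2 * (1 + G / (2 * δ)) + (G + 2 * δ) * F ^ 2 - G * (s + F) ^ 2 =
        (G * s - 2 * δ * F) ^ 2 / (2 * δ) := by field_simp; ring
    linarith
  -- The Young parameter is chosen so that its cost, with `P ≤ 2 / κ`, is exactly the surplus `G /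
  -- (δ * κ)`.
  have h1 : (1 + G / (2 * δ)) * P ≤ bellman δ κ t := by
    have : G / (2 * δ) * P ≤ G / (2 * δ) * (2 / κ) := by gcongr
    have e : G / (2 * δ) * (2 / κ) = G / (δ * κ) := by field_simp
    linarith
  have h2 : (G + 2 * δ) * P ≤ 6 * δ / κ := by
    calc (G + 2 * δ) * P ≤ (3 * δ) * (2 / κ) := by gcongr; linarith
      _ = 6 * δ / κ := by ring
  calc G * (s + F) ^ 2 * P ≤ (G * s ^ 2 * (1 + G / (2 * δ)) + (G + 2 * δ) * F ^ 2) * P := by gcongr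
    _ = G * s ^ 2 * ((1 + G / (2 * δ)) * P) + (G + 2 * δ) * P * F ^ 2 := by ring
    _ ≤ _ := by gcongr

end Bellman

/-- A weighted embedding on the tree: if `G` is superadditive and `F` lives where the potential of
`G` is at most `δ`, then `hardy F * G / (hardy G + κ)` has small `ℓ²` norm. -/
lemma tree_embedding {N : ℕ} {δ κ : ℝ} (hδ : 0 < δ) (hκ : 0 < κ) {F G : ℕ → ℕ → ℝ}
    (hG : ∀ l j, 0 ≤ G l j)
    (hsuper : ∀ l < N, ∀ j, G (l + 1) (2 * j) + G (l + 1) (2 * j + 1) ≤ G l j)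
    (hF : ∀ l j, F l j ≠ 0 → hardy G l j ≤ δ) :
    ∑ a : Tree N, (hardy F a.1 a.2 * G a.1 a.2 / (hardy G a.1 a.2 + κ)) ^ 2 ≤
      6 * δ / κ * ∑ a : Tree N, F a.1 a.2 ^ 2 := by
  rw [sum_tree N (fun l j => (hardy F l j * G l j / (hardy G l j + κ)) ^ 2),
    sum_tree N (fun l j => F l j ^ 2)]
  have hH := hardy_nonneg hG
  -- The energy still to be spent below a node: superadditivity of `G` lets a parent's `Q` cover
  -- both children.
  let Q : ℕ → ℕ → ℝ := fun l j => G l j * hardy F l j ^ 2 * bellman δ κ (hardy G l j)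
  have hQ : ∀ l j, 0 ≤ Q l j := fun l j =>
    mul_nonneg (mul_nonneg (hG l j) (sq_nonneg _)) (bellman_nonneg hκ (hH l j))
  suffices H : ∀ n ≤ N, ∑ k ∈ Finset.range (n + 1), ∑ j ∈ Finset.range (2 ^ k),
        (hardy F k j * G k j / (hardy G k j + κ)) ^ 2 + ∑ j ∈ Finset.range (2 ^ n), Q n j ≤
      6 * δ / κ * ∑ k ∈ Finset.range (n + 1), ∑ j ∈ Finset.range (2 ^ k), F k j ^ 2 by
    have := H N le_rfl
    have := Finset.sum_nonneg fun j (_ : j ∈ Finset.range (2 ^ N)) => hQ N j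
    linarith
  intro n
  induction n with
  | zero =>
    intro _
    have h := bellman_step (s := 0) (t := 0) (F := F 0 0) (G := G 0 0) hδ hκ le_rfl (hG _ _)
      (by have := hF 0 0; rw [hardy_zero] at this; simpa using this)
    simpa [Q, hardy_zero] using h
  | succ n ih =>
    intro hn
    have ih := ih (by omega)
    rw [Finset.sum_range_succ _ (n + 1), Finset.sum_range_succ _ (n + 1), mul_add]
    have hnode : ∀ j, (hardy F (n + 1) j * G (n + 1) j / (hardy G (n + 1) j + κ)) ^ 2 +
        Q (n + 1) j ≤ G (n + 1) j * (hardy F n (j / 2) ^ 2 * bellman δ κ (hardy G n (j / 2))) +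
          6 * δ / κ * F (n + 1) j ^ 2 := by
      intro j
      have := bellman_step (s := hardy F n (j / 2)) (F := F (n + 1) j) hδ hκ (hH n (j / 2))
        (hG (n + 1) j) (by rw [← hardy_succ]; exact hF (n + 1) j)
      simp only [Q, hardy_succ]
      linarith
    have hsum : ∑ j ∈ Finset.range (2 ^ (n + 1)),
        G (n + 1) j * (hardy F n (j / 2) ^ 2 * bellman δ κ (hardy G n (j / 2))) ≤
        ∑ j ∈ Finset.range (2 ^ n), Q n j := by
      rw [pow_succ', sum_range_two_mul]
      refine Finset.sum_le_sum fun j _ => ?_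
      have e1 : 2 * j / 2 = j := by omega
      have e2 : (2 * j + 1) / 2 = j := by omega
      have hb : 0 ≤ hardy F n j ^ 2 * bellman δ κ (hardy G n j) :=
        mul_nonneg (sq_nonneg _) (bellman_nonneg hκ (hH n j))
      rw [e1, e2, ← add_mul]
      calc _ ≤ G n j * _ := mul_le_mul_of_nonneg_right (hsuper n (by omega) j) hb
        _ = Q n j := by simp only [Q]; ring
    have := Finset.sum_le_sum fun j (_ : j ∈ Finset.range (2 ^ (n + 1))) => hnode j
    rw [Finset.sum_add_distrib, Finset.sum_add_distrib, ← Finset.mul_sum] at this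
    linarith

/-! ### Pointwise majorization of two-parameter partial sums. -/

section Pointwise

variable {δ κ : ℝ}

/-- Once the partial sum of `a` exceeds `δ`, that of `c` is frozen, and each further term on the
right pays for the growth of the fraction on the left. -/
lemma row_bound (hδ : 0 ≤ δ) (hκ : 0 < κ) {a c : ℕ → ℝ} (ha : ∀ l, 0 ≤ a l) (hc : ∀ l, 0 ≤ c l)
    (h : ∀ l, c l ≠ 0 → ∑ i ∈ Finset.range (l + 1), a i ≤ δ) (n : ℕ) :
    (∑ i ∈ Finset.range (n + 1), c i) *
        ((∑ i ∈ Finset.range (n + 1), a i - δ) / (∑ i ∈ Finset.range (n + 1), a i + κ)) ≤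
      ∑ l ∈ Finset.range (n + 1), a l * (∑ i ∈ Finset.range (l + 1), c i) /
        (∑ i ∈ Finset.range (l + 1), a i + κ) := by
  have hA : ∀ n, 0 ≤ ∑ i ∈ Finset.range n, a i := fun n => Finset.sum_nonneg fun _ _ => ha _
  have hB : ∀ n, 0 ≤ ∑ i ∈ Finset.range n, c i := fun n => Finset.sum_nonneg fun _ _ => hc _
  have hS : ∀ n, 0 ≤ ∑ l ∈ Finset.range n, a l * (∑ i ∈ Finset.range (l + 1), c i) /
        (∑ i ∈ Finset.range (l + 1), a i + κ) := fun n => Finset.sum_nonneg fun l _ =>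
    div_nonneg (mul_nonneg (ha _) (hB _)) (by linarith [hA (l + 1)])
  have triv : ∀ n, ∑ i ∈ Finset.range (n + 1), a i ≤ δ →
      (∑ i ∈ Finset.range (n + 1), c i) *
        ((∑ i ∈ Finset.range (n + 1), a i - δ) / (∑ i ∈ Finset.range (n + 1), a i + κ)) ≤ 0 :=
    fun n hn => mul_nonpos_of_nonneg_of_nonpos (hB _)
      (div_nonpos_of_nonpos_of_nonneg (by linarith) (by linarith [hA (n + 1)]))
  induction n with
  | zero =>
    simp only [zero_add, Finset.sum_range_one]
    rw [mul_div_assoc', mul_comm]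
    have := ha 0
    have := hc 0
    gcongr
    linarith
  | succ n ih =>
    by_cases hle : ∑ i ∈ Finset.range (n + 1 + 1), a i ≤ δ
    · exact (triv (n + 1) hle).trans (hS _)
    have hc0 : c (n + 1) = 0 := by
      by_contra hne; exact hle (h _ hne)
    rw [Finset.sum_range_succ (fun l => a l * _ / _)]
    rw [Finset.sum_range_succ c (n + 1), hc0, add_zero]
    rw [Finset.sum_range_succ a (n + 1)] at hle ⊢
    have hAn := hA (n + 1)
    have hBn := hB (n + 1)
    have hSn := hS (n + 1)
    have han := ha (n + 1)
    set A := ∑ i ∈ Finset.range (n + 1), a i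
    set B := ∑ i ∈ Finset.range (n + 1), c i
    set x := a (n + 1)
    by_cases hlt : A ≤ δ
    -- The threshold is crossed at this step: `A ≤ δ`, so the numerator is at most `x`.
    · have : B * ((A + x - δ) / (A + x + κ)) ≤ x * B / (A + x + κ) := by
        rw [mul_div_assoc', mul_comm x]
        gcongr
        linarith
      linarith
    · have : (A + x - δ) / (A + x + κ) ≤ (A - δ) / (A + κ) + x / (A + x + κ) := by
        rw [div_add_div _ _ (by positivity) (by positivity),
          div_le_div_iff₀ (by positivity) (by positivity)]
        have : 0 ≤ (A + x + κ) * (x * (A - δ)) :=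
          mul_nonneg (by positivity) (mul_nonneg han (by linarith))
        nlinarith
      have := mul_le_mul_of_nonneg_left this hBn
      have e : x * B / (A + x + κ) = B * (x / (A + x + κ)) := by ring
      rw [e]
      linarith

/-- While the partial sum is at most `3κ` there is nothing to do; beyond that the fraction is at
least `1/2`, so `b k ≤ 2 * r k`. -/
lemma column_bound (hδκ : δ ≤ κ) (hκ : 0 < κ) {b r : ℕ → ℝ} (hb : ∀ k, 0 ≤ b k)
    (hr : ∀ k, 0 ≤ r k)
    (h : ∀ k, b k * ((∑ i ∈ Finset.range (k + 1), b i - δ) /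
      (∑ i ∈ Finset.range (k + 1), b i + κ)) ≤ r k) (n : ℕ) :
    ∑ i ∈ Finset.range n, b i ≤ 3 * κ + 2 * ∑ k ∈ Finset.range n, r k := by
  induction n with
  | zero => simpa using hκ.le
  | succ n ih =>
    have hn := h n
    have hbn := hb n
    have hR : 0 ≤ ∑ k ∈ Finset.range (n + 1), r k := Finset.sum_nonneg fun _ _ => hr _
    by_cases hle : ∑ i ∈ Finset.range (n + 1), b i ≤ 3 * κ
    · linarith
    rw [Finset.sum_range_succ r]
    set S := ∑ i ∈ Finset.range (n + 1), b i with hS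
    have hhalf : 1 / 2 ≤ (S - δ) / (S + κ) := by
      rw [div_le_div_iff₀ (by norm_num) (by linarith)]
      linarith
    have := mul_le_mul_of_nonneg_left hhalf hbn
    rw [hS, Finset.sum_range_succ]
    linarith

/-- The pointwise majorization of a two-parameter partial sum whose terms sit where the partial
sums are at most `δ`. -/
lemma grid_majorization (hδ : 0 ≤ δ) (hδκ : δ ≤ κ) (hκ : 0 < κ) {c : ℕ → ℕ → ℝ}
    (hc : ∀ k l, 0 ≤ c k l) (n : ℕ)
    (h : ∀ k l, c k l ≠ 0 →
      ∑ j ∈ Finset.range (l + 1), ∑ i ∈ Finset.range (k + 1), c i j ≤ δ) :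
    ∑ k ∈ Finset.range (n + 1), ∑ l ∈ Finset.range (n + 1), c k l ≤
      3 * κ + 2 * ∑ k ∈ Finset.range (n + 1), ∑ l ∈ Finset.range (n + 1),
        (∑ i ∈ Finset.range (k + 1), c i l) * (∑ j ∈ Finset.range (l + 1), c k j) /
          (∑ j ∈ Finset.range (l + 1), ∑ i ∈ Finset.range (k + 1), c i j + κ) := by
  have hs : ∀ k l, 0 ≤ ∑ i ∈ Finset.range (k + 1), c i l :=
    fun k l => Finset.sum_nonneg fun _ _ => hc _ _
  refine column_bound hδκ hκ (fun k => Finset.sum_nonneg fun _ _ => hc _ _) (fun k =>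
    Finset.sum_nonneg fun l _ => div_nonneg (mul_nonneg (hs _ _)
      (Finset.sum_nonneg fun _ _ => hc _ _))
      (add_nonneg (Finset.sum_nonneg fun _ _ => hs _ _) hκ.le)) (fun k => ?_) _
  -- The sum of the first rows is also the full sum of their column totals, the sequence `a` of
  -- `row_bound`.
  rw [Finset.sum_comm (s := Finset.range (k + 1))]
  exact row_bound hδ hκ (hs k) (hc k) (h k) n

end Pointwise

/-! ### Bi-parameter potentials and the small energy estimate. -/

/-- The bi-parameter Hardy operator. -/
def potential (f : ℕ → ℕ → ℕ → ℕ → ℝ) (k i l j : ℕ) : ℝ :=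
  hardy (fun l j => hardy (fun k i => f k i l j) k i) l j

lemma potential_mono {f g : ℕ → ℕ → ℕ → ℕ → ℝ} (h : ∀ k i l j, f k i l j ≤ g k i l j)
    (k i l j : ℕ) : potential f k i l j ≤ potential g k i l j :=
  hardy_mono (fun _ _ => hardy_mono (fun _ _ => h _ _ _ _) _ _) _ _

lemma potential_succ (f : ℕ → ℕ → ℕ → ℕ → ℝ) (k i l j : ℕ) :
    potential f k i (l + 1) j =
      potential f k i l (j / 2) + hardy (fun k i => f k i (l + 1) j) k i :=
  hardy_succ _ _ _

lemma potential_branch (f : ℕ → ℕ → ℕ → ℕ → ℝ) {N k l : ℕ} (hk : k ≤ N) (hl : l ≤ N) (x y : ℕ) :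
    potential f k (x / 2 ^ (N - k)) l (y / 2 ^ (N - l)) =
      ∑ j ∈ Finset.range (l + 1), ∑ i ∈ Finset.range (k + 1),
        f i (x / 2 ^ (N - i)) j (y / 2 ^ (N - j)) := by
  unfold potential
  rw [hardy_branch _ hl]
  exact Finset.sum_congr rfl fun j _ => hardy_branch _ hk x

lemma potential_leaf (f : ℕ → ℕ → ℕ → ℕ → ℝ) (N x y : ℕ) :
    potential f N x N y = ∑ k ∈ Finset.range (N + 1), ∑ l ∈ Finset.range (N + 1),
        f k (x / 2 ^ (N - k)) l (y / 2 ^ (N - l)) := by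
  have := potential_branch f (le_refl N) (le_refl N) x y
  rw [Finset.sum_comm, ← this]
  simp

lemma potential_branch_le {f : ℕ → ℕ → ℕ → ℕ → ℝ} (hf : ∀ k i l j, 0 ≤ f k i l j) {N k l : ℕ}
    (hk : k ≤ N) (hl : l ≤ N) (x y : ℕ) :
    potential f k (x / 2 ^ (N - k)) l (y / 2 ^ (N - l)) ≤ potential f N x N y :=
  (hardy_branch_le (fun _ _ => hardy_nonneg (fun _ _ => hf _ _ _ _) _ _) hl y).trans
    (hardy_mono (fun _ _ => hardy_branch_le (fun _ _ => hf _ _ _ _) hk x) _ _)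

/-- The mass of the dyadic rectangle with coordinates `k i l j`. -/
def boxMass {N : ℕ} (ν : Boundary N → ℝ≥0) (k i l j : ℕ) : ℝ :=
  ∑ ω : Boundary N,
    if (ω.1 : ℕ) / 2 ^ (N - k) = i ∧ (ω.2 : ℕ) / 2 ^ (N - l) = j then (ν ω : ℝ) else 0

section

variable {N : ℕ} (ν : Boundary N → ℝ≥0)

lemma boxMass_nonneg (k i l j : ℕ) : 0 ≤ boxMass ν k i l j :=
  Finset.sum_nonneg fun ω _ => by split_ifs <;> positivity

lemma boxMass_children (k i : ℕ) {l : ℕ} (hl : l < N) (j : ℕ) :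
    boxMass ν k i (l + 1) (2 * j) + boxMass ν k i (l + 1) (2 * j + 1) ≤ boxMass ν k i l j := by
  unfold boxMass
  rw [← Finset.sum_add_distrib]
  refine Finset.sum_le_sum fun ω _ => ?_
  have e : N - l = (N - (l + 1)) + 1 := by omega
  rw [e, pow_succ, ← Nat.div_div_eq_div_mul]
  have := (ν ω).2
  generalize (ω.2 : ℕ) / 2 ^ (N - (l + 1)) = y
  split_ifs <;> first | omega | simp

lemma sum_tree_branch {x : ℕ} (hx : x < 2 ^ N) (h : ℕ → ℕ → ℝ) :
    ∑ a : Tree N, (if x / 2 ^ (N - (a.1 : ℕ)) = a.2 then h a.1 a.2 else 0) =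
      ∑ k ∈ Finset.range (N + 1), h k (x / 2 ^ (N - k)) := by
  rw [sum_tree N (fun k i => if x / 2 ^ (N - k) = i then h k i else 0)]
  refine Finset.sum_congr rfl fun k hk => ?_
  rw [Finset.sum_ite_eq, if_pos]
  rw [Finset.mem_range] at hk ⊢
  rw [Nat.div_lt_iff_lt_mul (by positivity), ← pow_add]
  rwa [show k + (N - k) = N by omega]

/-- The bi-parameter Hardy operator is adjoint to `boxMass`. -/
lemma sum_mul_potential (f : ℕ → ℕ → ℕ → ℕ → ℝ) :
    ∑ ω : Boundary N, (ν ω : ℝ) * potential f N ω.1 N ω.2 =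
      ∑ α : Node N, f α.1.1 α.1.2 α.2.1 α.2.2 * boxMass ν α.1.1 α.1.2 α.2.1 α.2.2 := by
  simp only [boxMass, Finset.mul_sum]
  rw [Finset.sum_comm]
  refine Finset.sum_congr rfl fun ω _ => ?_
  rw [potential_leaf, ← sum_tree_branch ω.1.2 (fun k i => ∑ l ∈ Finset.range (N + 1),
        f k i l ((ω.2 : ℕ) / 2 ^ (N - l))), Finset.mul_sum, Fintype.sum_prod_type]
  refine Finset.sum_congr rfl fun a _ => ?_
  rw [← sum_tree_branch ω.2.2 (fun l j => f a.1 a.2 l j)]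
  by_cases h : (ω.1 : ℕ) / 2 ^ (N - (a.1 : ℕ)) = a.2
  · simp only [h, if_true, true_and, Finset.mul_sum]
    refine Finset.sum_congr rfl fun b _ => ?_
    split_ifs <;> ring
  · simp [h]

open Classical in
/-- The part of `boxMass ν` living where its potential is at most `δ`. -/
noncomputable def lowMass (δ : ℝ) (k i l j : ℕ) : ℝ :=
  if potential (boxMass ν) k i l j ≤ δ then boxMass ν k i l j else 0

variable {δ κ : ℝ}

lemma lowMass_nonneg (k i l j : ℕ) : 0 ≤ lowMass ν δ k i l j := by
  unfold lowMass; split_ifs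
  · exact boxMass_nonneg _ _ _ _ _
  · exact le_rfl

lemma lowMass_le (k i l j : ℕ) : lowMass ν δ k i l j ≤ boxMass ν k i l j := by
  unfold lowMass; split_ifs
  · exact le_rfl
  · exact boxMass_nonneg _ _ _ _ _

lemma potential_lowMass_le {k i l j : ℕ} (h : lowMass ν δ k i l j ≠ 0) :
    potential (lowMass ν δ) k i l j ≤ δ := by
  have : potential (boxMass ν) k i l j ≤ δ := by
    by_contra hn; exact h (by simp [lowMass, hn])
  exact (potential_mono (lowMass_le ν) k i l j).trans this

/-- The potential grows towards descendants, so where a node is cut off its children are too; the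
cut-off keeps superadditivity. -/
lemma lowMass_children (k i : ℕ) {l : ℕ} (hl : l < N) (j : ℕ) :
    lowMass ν δ k i (l + 1) (2 * j) + lowMass ν δ k i (l + 1) (2 * j + 1) ≤
      lowMass ν δ k i l j := by
  by_cases h : potential (boxMass ν) k i l j ≤ δ
  · calc _ ≤ boxMass ν k i (l + 1) (2 * j) + boxMass ν k i (l + 1) (2 * j + 1) :=
          add_le_add (lowMass_le _ _ _ _ _) (lowMass_le _ _ _ _ _)
      _ ≤ boxMass ν k i l j := boxMass_children ν k i hl j
      _ = _ := by simp [lowMass, h]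
  · have hc : ∀ j', j' / 2 = j → lowMass ν δ k i (l + 1) j' = 0 := by
      intro j' hj'
      have : ¬ potential (boxMass ν) k i (l + 1) j' ≤ δ := by
        rw [potential_succ, hj']
        have := hardy_nonneg (F := fun k i => boxMass ν k i (l + 1) j')
          (fun _ _ => boxMass_nonneg _ _ _ _ _) k i
        linarith
      simp [lowMass, this]
    rw [hc _ (by omega), hc _ (by omega), add_zero]
    exact lowMass_nonneg _ _ _ _ _

/-- The function whose potential majorizes that of `lowMass`. -/
noncomputable def majorant (δ κ : ℝ) (k i l j : ℕ) : ℝ :=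
  hardy (fun k i => lowMass ν δ k i l j) k i * hardy (lowMass ν δ k i) l j /
    (potential (lowMass ν δ) k i l j + κ)

/-- Freeze the first coordinate and apply `tree_embedding` in the second, with `G` the sum over
ancestors in the first; then `hardy G` is the potential. -/
lemma sum_majorant_sq_le (hδ : 0 < δ) (hκ : 0 < κ) :
    ∑ α : Node N, majorant ν δ κ α.1.1 α.1.2 α.2.1 α.2.2 ^ 2 ≤
      6 * δ / κ * ∑ α : Node N, lowMass ν δ α.1.1 α.1.2 α.2.1 α.2.2 ^ 2 := by
  rw [Fintype.sum_prod_type, Fintype.sum_prod_type, Finset.mul_sum]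
  refine Finset.sum_le_sum fun a _ => ?_
  have := tree_embedding (N := N) hδ hκ (F := lowMass ν δ a.1 a.2)
    (G := fun l j => hardy (fun k i => lowMass ν δ k i l j) a.1 a.2)
    (fun l j => hardy_nonneg (fun _ _ => lowMass_nonneg _ _ _ _ _) _ _)
    (fun l hl j => by
      unfold hardy
      rw [← Finset.sum_add_distrib]
      exact Finset.sum_le_sum fun _ _ => lowMass_children ν _ _ hl _)
    (fun l j h => potential_lowMass_le ν h)
  refine le_of_eq_of_le ?_ this
  refine Finset.sum_congr rfl fun b _ => ?_
  simp only [majorant, potential]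
  rw [mul_comm (hardy (fun k i => _) _ _)]

lemma potential_lowMass_majorant (hδ : 0 ≤ δ) (hδκ : δ ≤ κ) (hκ : 0 < κ) (x y : ℕ) :
    potential (lowMass ν δ) N x N y ≤ 3 * κ + 2 * potential (majorant ν δ κ) N x N y := by
  -- Extension by zero past level `N`, where `N - k` truncates and the branch formula fails.
  have h := grid_majorization hδ hδκ hκ
    (c := fun k l => if k ≤ N ∧ l ≤ N then
      lowMass ν δ k (x / 2 ^ (N - k)) l (y / 2 ^ (N - l)) else 0)
    (fun k l => by split_ifs <;> [exact lowMass_nonneg _ _ _ _ _; exact le_rfl]) N ?_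
  · rw [potential_leaf, potential_leaf]
    have e1 : ∀ k ∈ Finset.range (N + 1), ∀ l ∈ Finset.range (N + 1), k ≤ N ∧ l ≤ N := by
      intro k hk l hl; simp only [Finset.mem_range] at hk hl; omega
    refine le_of_eq_of_le ?_ (h.trans_eq ?_)
    · refine Finset.sum_congr rfl fun k hk => Finset.sum_congr rfl fun l hl => ?_
      rw [if_pos (e1 k hk l hl)]
    · congr 2
      refine Finset.sum_congr rfl fun k hk => Finset.sum_congr rfl fun l hl => ?_
      obtain ⟨hkN, hlN⟩ := e1 k hk l hl
      have hle : ∀ i ∈ Finset.range (k + 1), ∀ j ∈ Finset.range (l + 1), i ≤ N ∧ j ≤ N := by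
        intro i hi j hj; simp only [Finset.mem_range] at hi hj; omega
      rw [majorant, potential_branch _ hkN hlN, hardy_branch _ hkN, hardy_branch _ hlN]
      congr 2
      · exact Finset.sum_congr rfl fun i hi => if_pos (hle i hi l (by simp))
      · exact Finset.sum_congr rfl fun j hj => if_pos (hle k (by simp) j hj)
      · exact Finset.sum_congr rfl fun j hj => Finset.sum_congr rfl fun i hi =>
          if_pos (hle i hi j hj)
  · intro k l hne
    have hkl : k ≤ N ∧ l ≤ N := by
      by_contra hn; exact hne (if_neg hn)
    rw [if_pos hkl] at hne
    have := potential_lowMass_le ν hne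
    rw [potential_branch _ hkl.1 hkl.2] at this
    refine le_of_eq_of_le (Finset.sum_congr rfl fun j hj => Finset.sum_congr rfl fun i hi => ?_)
      this
    simp only [Finset.mem_range] at hi hj
    exact if_pos (by omega)

/-- The small energy estimate: the nodes of small potential carry a small part of the energy. -/
lemma sum_lowMass_sq_le (hκ : 0 < κ) (hδ : δ = κ / 384) :
    ∑ α : Node N, lowMass ν δ α.1.1 α.1.2 α.2.1 α.2.2 ^ 2 ≤
      3 * κ * ∑ ω, (ν ω : ℝ) + 1 / 4 * ∑ α : Node N, boxMass ν α.1.1 α.1.2 α.2.1 α.2.2 ^ 2 := by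
  have hδ0 : 0 < δ := by rw [hδ]; positivity
  set X := ∑ α : Node N, lowMass ν δ α.1.1 α.1.2 α.2.1 α.2.2 ^ 2
  set E := ∑ α : Node N, boxMass ν α.1.1 α.1.2 α.2.1 α.2.2 ^ 2 with hE
  set P := ∑ α : Node N, majorant ν δ κ α.1.1 α.1.2 α.2.1 α.2.2 *
    boxMass ν α.1.1 α.1.2 α.2.1 α.2.2 with hP
  have hE0 : 0 ≤ E := Finset.sum_nonneg fun _ _ => sq_nonneg _
  have hXE : X ≤ E := Finset.sum_le_sum fun α _ =>
    pow_le_pow_left₀ (lowMass_nonneg _ _ _ _ _) (lowMass_le _ _ _ _ _) 2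
  -- `lowMass` is `0` or `boxMass`, so its product with `boxMass` is its square.
  have hXeq : X = ∑ ω : Boundary N, (ν ω : ℝ) * potential (lowMass ν δ) N ω.1 N ω.2 := by
    rw [sum_mul_potential]
    refine Finset.sum_congr rfl fun α _ => ?_
    unfold lowMass
    split_ifs <;> ring
  have h1 : X ≤ 3 * κ * ∑ ω, (ν ω : ℝ) + 2 * P := by
    rw [hXeq, hP, ← sum_mul_potential, Finset.mul_sum, Finset.mul_sum, ← Finset.sum_add_distrib]
    refine Finset.sum_le_sum fun ω _ => ?_
    have := mul_le_mul_of_nonneg_left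
      (potential_lowMass_majorant ν hδ0.le (by rw [hδ]; linarith) hκ ω.1 ω.2) (ν ω).2
    calc _ ≤ _ := this
      _ = _ := by simp only [NNReal.val_eq_coe]; ring
  -- The ratio `384` makes `6 * δ / κ = 1 / 64`, hence `2 * P ≤ E / 4`.
  have h2 : P ^ 2 ≤ (E / 8) ^ 2 := by
    calc P ^ 2 ≤ (∑ α : Node N, majorant ν δ κ α.1.1 α.1.2 α.2.1 α.2.2 ^ 2) * E :=
          Finset.sum_mul_sq_le_sq_mul_sq _ _ _
      _ ≤ (6 * δ / κ * X) * E := by gcongr; exact sum_majorant_sq_le ν hδ0 hκ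
      _ ≤ (6 * δ / κ * E) * E := by gcongr
      _ = (E / 8) ^ 2 := by rw [hδ]; field_simp; ring
  have h3 : P ≤ E / 8 := (abs_le_of_sq_le_sq' h2 (by positivity)).2
  linarith

end

/-! ### Dyadic rectangles in integer coordinates. -/

section Geometry

variable {N : ℕ}

lemma two_pow_split (k : Fin (N + 1)) : 2 ^ N = 2 ^ (k : ℕ) * 2 ^ (N - (k : ℕ)) := by
  rw [← pow_add, Nat.add_sub_cancel' (Nat.lt_succ_iff.1 k.2)]

lemma div_eq_iff_bounds {x j m : ℕ} : x / 2 ^ m = j ↔ j * 2 ^ m ≤ x ∧ x + 1 ≤ (j + 1) * 2 ^ m := by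
  rw [← Nat.le_div_iff_mul_le (by positivity), Nat.succ_le_iff,
    ← Nat.div_lt_iff_lt_mul (by positivity)]
  omega

lemma interval_leaf_subset_iff (x : Fin (2 ^ N)) (a : Tree N) :
    interval (⟨Fin.last N, x⟩ : Tree N) ⊆ interval a ↔
      (x : ℕ) / 2 ^ (N - (a.1 : ℕ)) = (a.2 : ℕ) := by
  have hN : (2 : ℝ) ^ N = 2 ^ (a.1 : ℕ) * 2 ^ (N - (a.1 : ℕ)) := by
    exact_mod_cast two_pow_split a.1
  unfold interval
  rw [Set.Icc_subset_Icc_iff (by gcongr; simp), div_eq_iff_bounds]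
  simp only [Fin.val_last]
  rw [hN, div_le_div_iff₀ (by positivity) (by positivity),
    div_le_div_iff₀ (by positivity) (by positivity)]
  have h0 : (0 : ℝ) < 2 ^ (a.1 : ℕ) := by positivity
  refine and_congr ?_ ?_
  · rw [← Nat.cast_le (α := ℝ)]
    push_cast
    constructor <;> intro h
    · exact le_of_mul_le_mul_left (by linarith) h0
    · have := mul_le_mul_of_nonneg_left h h0.le
      linarith
  · rw [← Nat.cast_le (α := ℝ)]
    push_cast
    constructor <;> intro h
    · exact le_of_mul_le_mul_left (by linarith) h0
    · have := mul_le_mul_of_nonneg_left h h0.le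
      linarith

lemma interval_nonempty (a : Tree N) : (interval a).Nonempty :=
  Set.nonempty_Icc.2 (by gcongr; simp)

lemma rect_leaf_subset_iff (ω : Boundary N) (α : Node N) :
    rect (leaf ω) ⊆ rect α ↔ (ω.1 : ℕ) / 2 ^ (N - (α.1.1 : ℕ)) = (α.1.2 : ℕ) ∧
      (ω.2 : ℕ) / 2 ^ (N - (α.2.1 : ℕ)) = (α.2.2 : ℕ) := by
  unfold rect
  rw [Set.prod_subset_prod_iff, ← interval_leaf_subset_iff, ← interval_leaf_subset_iff]
  simp [(interval_nonempty _).ne_empty, leaf]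

lemma exists_leaf_interval {a : Tree N} {p : ℝ} (hp : p ∈ interval a) :
    ∃ x : Fin (2 ^ N), p ∈ interval (⟨Fin.last N, x⟩ : Tree N) ∧
      (x : ℕ) / 2 ^ (N - (a.1 : ℕ)) = (a.2 : ℕ) := by
  have hN : (2 : ℝ) ^ N = 2 ^ (a.1 : ℕ) * 2 ^ (N - (a.1 : ℕ)) := by
    exact_mod_cast two_pow_split a.1
  have hN' := two_pow_split a.1
  obtain ⟨h1, h2⟩ := hp
  rw [div_le_iff₀ (by positivity)] at h1
  rw [le_div_iff₀ (by positivity)] at h2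
  have hj := a.2.2
  set m := N - (a.1 : ℕ)
  have hm : 1 ≤ 2 ^ m := Nat.one_le_two_pow
  have hq1 : ((a.2 * 2 ^ m : ℕ) : ℝ) ≤ p * 2 ^ N := by
    push_cast; rw [hN]
    have := mul_le_mul_of_nonneg_right h1 (by positivity : (0 : ℝ) ≤ 2 ^ m)
    linarith
  have hq2 : p * 2 ^ N ≤ (((a.2 + 1) * 2 ^ m : ℕ) : ℝ) := by
    push_cast; rw [hN]
    have := mul_le_mul_of_nonneg_right h2 (by positivity : (0 : ℝ) ≤ 2 ^ m)
    linarith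
  have hp0 : 0 ≤ p * 2 ^ N := le_trans (Nat.cast_nonneg _) hq1
  have hfl : (⌊p * 2 ^ N⌋₊ : ℝ) ≤ p * 2 ^ N := Nat.floor_le hp0
  have hfl2 := Nat.lt_floor_add_one (p * 2 ^ N)
  have hfl3 : a.2 * 2 ^ m ≤ ⌊p * 2 ^ N⌋₊ := Nat.le_floor hq1
  have hb : ((a.2 : ℕ) + 1) * 2 ^ m ≤ 2 ^ N := by rw [hN']; gcongr; omega
  have hs : ((a.2 : ℕ) + 1) * 2 ^ m = a.2 * 2 ^ m + 2 ^ m := by ring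
  have key : ∀ x : ℕ, a.2 * 2 ^ m ≤ x → x + 1 ≤ (a.2 + 1) * 2 ^ m → (x : ℝ) ≤ p * 2 ^ N →
      p * 2 ^ N ≤ x + 1 → ∃ x : Fin (2 ^ N), p ∈ interval (⟨Fin.last N, x⟩ : Tree N) ∧
      (x : ℕ) / 2 ^ m = (a.2 : ℕ) := fun x h1 h2 h3 h4 =>
    ⟨⟨x, by omega⟩, ⟨(div_le_iff₀ (by positivity)).2 h3, (le_div_iff₀ (by positivity)).2 h4⟩,
      div_eq_iff_bounds.2 ⟨h1, h2⟩⟩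
  -- If `p` is the right endpoint, its floor falls in the next interval, and the last leaf under `a`
  -- is used instead.
  by_cases hlt : ⌊p * 2 ^ N⌋₊ + 1 ≤ (a.2 + 1) * 2 ^ m
  · exact key _ hfl3 hlt hfl hfl2.le
  · obtain ⟨n, hn⟩ : ∃ n, ((a.2 : ℕ) + 1) * 2 ^ m = n + 1 :=
      ⟨_, (Nat.sub_add_cancel (by omega)).symm⟩
    have : (n : ℝ) ≤ ⌊p * 2 ^ N⌋₊ := by
      have : n ≤ ⌊p * 2 ^ N⌋₊ := by omega
      exact_mod_cast this
    refine key n (by omega) hn.ge (by linarith) ?_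
    rw [hn] at hq2
    exact_mod_cast hq2

lemma leaf_interval_inj {x x' : Fin (2 ^ N)}
    (h : ((x : ℝ) + 1 / 2) / 2 ^ N ∈ interval (⟨Fin.last N, x'⟩ : Tree N)) : x = x' := by
  obtain ⟨h1, h2⟩ := h
  simp only [Fin.val_last] at h1 h2
  have h3 := (div_le_div_iff_of_pos_right (by positivity)).1 h1
  have h4 := (div_le_div_iff_of_pos_right (by positivity)).1 h2
  have h5 : ((x' : ℕ) : ℝ) < ((x + 1 : ℕ) : ℝ) := by push_cast; linarith
  have h6 : ((x : ℕ) : ℝ) < ((x' + 1 : ℕ) : ℝ) := by push_cast; linarith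
  rw [Nat.cast_lt] at h5 h6
  exact Fin.ext (by omega)

lemma mem_interval_center (x : Fin (2 ^ N)) :
    ((x : ℝ) + 1 / 2) / 2 ^ N ∈ interval (⟨Fin.last N, x⟩ : Tree N) := by
  constructor <;> simp only [Fin.val_last] <;> gcongr <;> linarith

lemma mem_rectsIn_iff {E : Finset (Boundary N)} {α : Node N} :
    α ∈ rectsIn E ↔ ∀ ω, rect (leaf ω) ⊆ rect α → ω ∈ E := by
  simp only [rectsIn, Finset.mem_filter, Finset.mem_univ, true_and]
  constructor
  · intro h ω hω
    -- Closed squares share edges; the centre of a square lies in no other leaf square.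
    have hc : (((ω.1 : ℝ) + 1 / 2) / 2 ^ N, ((ω.2 : ℝ) + 1 / 2) / 2 ^ N) ∈ rect (leaf ω) :=
      ⟨mem_interval_center ω.1, mem_interval_center ω.2⟩
    obtain ⟨ω', hω', hm⟩ := Set.mem_iUnion₂.1 (h (hω hc))
    have : ω = ω' := Prod.ext (leaf_interval_inj hm.1) (leaf_interval_inj hm.2)
    rwa [this]
  · rintro h p ⟨hp1, hp2⟩
    obtain ⟨x, hx, hxa⟩ := exists_leaf_interval hp1
    obtain ⟨y, hy, hya⟩ := exists_leaf_interval hp2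
    exact Set.mem_iUnion₂.2
      ⟨(x, y), h (x, y) ((rect_leaf_subset_iff _ _).2 ⟨hxa, hya⟩), hx, hy⟩

lemma rectMass_eq_boxMass (μ : Boundary N → ℝ≥0) (α : Node N) :
    rectMass μ α = boxMass μ α.1.1 α.1.2 α.2.1 α.2.2 := by
  unfold rectMass mass boxMass
  rw [Finset.sum_filter]
  simp only [rect_leaf_subset_iff]

end Geometry

/-! ### Restrictions and the easy implications. -/

section Restriction

variable {N : ℕ} (μ : Boundary N → ℝ≥0)

lemma mass_nonneg (E : Finset (Boundary N)) : 0 ≤ mass μ E :=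
  Finset.sum_nonneg fun _ _ => NNReal.coe_nonneg _

lemma mass_restrict (E F : Finset (Boundary N)) : mass (restrict μ E) F = mass μ (E ∩ F) := by
  unfold mass restrict
  rw [Finset.inter_comm, ← Finset.filter_mem_eq_inter, Finset.sum_filter]
  exact Finset.sum_congr rfl fun ω _ => by split_ifs <;> simp

lemma restrict_restrict (E F : Finset (Boundary N)) :
    restrict (restrict μ E) F = restrict μ (E ∩ F) := by
  funext ω
  by_cases h1 : ω ∈ E <;> by_cases h2 : ω ∈ F <;> simp [restrict, h1, h2]

lemma restrict_le (E : Finset (Boundary N)) (ω : Boundary N) : restrict μ E ω ≤ μ ω := by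
  unfold restrict; split_ifs <;> simp

lemma sum_restrict (E : Finset (Boundary N)) :
    ∑ ω, (restrict μ E ω : ℝ) = mass μ E := by
  have := mass_restrict μ E Finset.univ
  rwa [Finset.inter_univ] at this

lemma rectMass_nonneg (α : Node N) : 0 ≤ rectMass μ α := mass_nonneg _ _

lemma rectMass_restrict_le (E : Finset (Boundary N)) (α : Node N) :
    rectMass (restrict μ E) α ≤ rectMass μ α :=
  Finset.sum_le_sum fun ω _ => NNReal.coe_le_coe.2 (restrict_le μ E ω)

lemma rectMass_restrict_of_mem {E : Finset (Boundary N)} {α : Node N} (hα : α ∈ rectsIn E) :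
    rectMass (restrict μ E) α = rectMass μ α := by
  refine Finset.sum_congr rfl fun ω hω => ?_
  have hω : rect (leaf ω) ⊆ rect α := by simpa using hω
  rw [restrict, if_pos (mem_rectsIn_iff.1 hα ω hω)]

lemma energy_restrict_eq_zero {E : Finset (Boundary N)} (h : mass μ E = 0) :
    energy (restrict μ E) = 0 := by
  have h0 : ∀ ω ∈ E, (μ ω : ℝ) = 0 :=
    (Finset.sum_eq_zero_iff_of_nonneg fun _ _ => NNReal.coe_nonneg _).1 h
  refine Finset.sum_eq_zero fun α _ => ?_
  rw [sq_eq_zero_iff]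
  refine Finset.sum_eq_zero fun ω _ => ?_
  unfold restrict
  split_ifs with hω
  · exact h0 ω hω
  · simp

variable {μ} {C : ℝ}

lemma IsREC.mono {C' : ℝ} (h : IsREC C μ) (hC : C ≤ C') : IsREC C' μ := fun E =>
  (h E).trans (mul_le_mul_of_nonneg_right hC (mass_nonneg _ _))

lemma IsREC.restrict (h : IsREC C μ) (E : Finset (Boundary N)) : IsREC C (restrict μ E) := by
  intro F
  rw [restrict_restrict, mass_restrict]
  exact h _

lemma IsREC.isCarleson (h : IsREC C μ) : IsCarleson C μ := fun E =>
  calc localEnergy E μ = ∑ α ∈ rectsIn E, rectMass (BiTree.restrict μ E) α ^ 2 :=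
        Finset.sum_congr rfl fun α hα => by rw [rectMass_restrict_of_mem μ hα]
    _ ≤ energy (BiTree.restrict μ E) :=
        Finset.sum_le_univ_sum_of_nonneg fun _ => sq_nonneg _
    _ ≤ C * mass μ E := h E

lemma IsREC.isHereditaryCarleson (h : IsREC C μ) : IsHereditaryCarleson C μ :=
  fun E => (h.restrict E).isCarleson

lemma IsHereditaryCarleson.isCarleson (h : IsHereditaryCarleson C μ) : IsCarleson C μ := by
  have := h Finset.univ
  rwa [show BiTree.restrict μ Finset.univ = μ by funext ω; simp [BiTree.restrict]] at this

end Restriction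

/-! ### From Carleson to restricted energy through an extremal set. -/

section Main

variable {N : ℕ} {μ : Boundary N → ℝ≥0} {C a : ℝ}

/-- If `a` is a restricted energy constant for `μ`, the set where the potential of `μ|E` exceeds
`δ` has mass controlled by that of `E`. -/
lemma sq_mul_mass_le (h : IsREC a μ) (ha : 0 ≤ a) {δ : ℝ} (hδ : 0 ≤ δ)
    {E F : Finset (Boundary N)}
    (hF : ∀ ω ∈ F, δ ≤ potential (boxMass (restrict μ E)) N ω.1 N ω.2) :
    δ ^ 2 * mass μ F ≤ a ^ 2 * mass μ E := by
  have hE0 := mass_nonneg μ E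
  have hF0 := mass_nonneg μ F
  set P := ∑ α : Node N, rectMass (restrict μ E) α * rectMass (restrict μ F) α with hP
  have h1 : δ * mass μ F ≤ P := by
    have e : P = ∑ ω : Boundary N, (restrict μ F ω : ℝ) *
        potential (boxMass (restrict μ E)) N ω.1 N ω.2 := by
      rw [sum_mul_potential]
      simp only [hP, rectMass_eq_boxMass]
    rw [e, ← sum_restrict μ F, Finset.mul_sum]
    refine Finset.sum_le_sum fun ω _ => ?_
    rw [mul_comm]
    by_cases hω : ω ∈ F
    · exact mul_le_mul_of_nonneg_left (hF ω hω) (NNReal.coe_nonneg _)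
    · simp [restrict, hω]
  have h2 : P ^ 2 ≤ (a * mass μ E) * (a * mass μ F) :=
    (Finset.sum_mul_sq_le_sq_mul_sq _ _ _).trans
      (mul_le_mul (h E) (h F) (Finset.sum_nonneg fun _ _ => sq_nonneg _) (by positivity))
  have h3 : (δ * mass μ F) ^ 2 ≤ P ^ 2 := pow_le_pow_left₀ (by positivity) h1 2
  rcases hF0.eq_or_lt with h0 | hpos
  -- If `F` has no mass nothing is claimed; otherwise one factor `mass μ F` cancels.
  · rw [← h0, mul_zero]; positivity
  · refine le_of_mul_le_mul_right ?_ hpos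
    linarith

/-- A Carleson measure whose restricted energy constant `a` is attained at a set of positive mass
has `a` comparable with its Carleson constant. -/
lemma IsCarleson.extremal_le (hC : IsCarleson C μ) (hC0 : 0 ≤ C) (h : IsREC a μ) (ha : 0 < a)
    {E : Finset (Boundary N)} (hE : 0 < mass μ E)
    (hEa : energy (restrict μ E) = a * mass μ E) : a ≤ 42467328 * C := by
  classical
  set ν := restrict μ E with hν
  -- With `κ = a / 12`, the term `3 * κ` is `a / 4`, so low nodes carry at most `a / 4 + a / 4`
  -- times `mass μ E`. The constant below is `(12 * 384) ^ 2`.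
  set δ : ℝ := a / 12 / 384 with hδ
  set F : Finset (Boundary N) := {ω | δ < potential (boxMass ν) N ω.1 N ω.2} with hF
  have hmass : mass μ F ≤ 21233664 * mass μ E := by
    have := sq_mul_mass_le (F := F) h ha.le (δ := δ) (by positivity)
      (fun ω hω => (Finset.mem_filter.1 hω).2.le)
    rw [hδ] at this
    have ha2 : 0 < a ^ 2 := by positivity
    refine le_of_mul_le_mul_left ?_ ha2
    linarith
  have hlow := sum_lowMass_sq_le ν (κ := a / 12) (δ := δ) (by positivity) hδ
  have hen : energy ν = ∑ α : Node N, boxMass ν α.1.1 α.1.2 α.2.1 α.2.2 ^ 2 :=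
    Finset.sum_congr rfl fun α _ => by rw [rectMass_eq_boxMass]
  rw [← hen, hEa, hν, sum_restrict, ← hν] at hlow
  have hsplit : energy ν ≤ ∑ α : Node N, lowMass ν δ α.1.1 α.1.2 α.2.1 α.2.2 ^ 2 +
      localEnergy F μ := by
    have e : localEnergy F μ = ∑ α : Node N, if α ∈ rectsIn F then rectMass μ α ^ 2 else 0 := by
      rw [localEnergy, ← Finset.sum_filter, Finset.filter_univ_mem]
    rw [e, hen, ← Finset.sum_add_distrib]
    refine Finset.sum_le_sum fun α _ => ?_
    by_cases hα : potential (boxMass ν) α.1.1 α.1.2 α.2.1 α.2.2 ≤ δ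
    · rw [lowMass, if_pos hα]
      have : 0 ≤ if α ∈ rectsIn F then rectMass μ α ^ 2 else 0 := by
        split_ifs <;> positivity
      linarith
    · have hmem : α ∈ rectsIn F := by
        refine mem_rectsIn_iff.2 fun ω hω => ?_
        obtain ⟨h1, h2⟩ := (rect_leaf_subset_iff _ _).1 hω
        refine Finset.mem_filter.2 ⟨Finset.mem_univ _, (not_le.1 hα).trans_le ?_⟩
        rw [← h1, ← h2]
        exact potential_branch_le (boxMass_nonneg ν) (Nat.lt_succ_iff.1 α.1.1.2)
          (Nat.lt_succ_iff.1 α.2.1.2) _ _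
      rw [lowMass, if_neg hα, if_pos hmem, ← rectMass_eq_boxMass]
      have := pow_le_pow_left₀ (rectMass_nonneg ν α) (rectMass_restrict_le μ E α) 2
      linarith
  have hloc := hC F
  have hCm : C * mass μ F ≤ C * (21233664 * mass μ E) := by gcongr
  refine le_of_mul_le_mul_right ?_ hE
  linarith

lemma IsCarleson.isREC (hC : IsCarleson C μ) (hC0 : 0 ≤ C) : IsREC (42467328 * C) μ := by
  -- There are finitely many sets, so the best constant is attained; massless sets have quotient `0`
  -- by convention.
  obtain ⟨E, -, hE⟩ := Finset.exists_max_image (Finset.univ : Finset (Finset (Boundary N)))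
    (fun F => energy (restrict μ F) / mass μ F) Finset.univ_nonempty
  set a := energy (restrict μ E) / mass μ E with ha
  have hrec : IsREC a μ := by
    intro F
    rcases (mass_nonneg μ F).eq_or_lt with h0 | hpos
    · rw [energy_restrict_eq_zero μ h0.symm, ← h0, mul_zero]
    · exact (div_le_iff₀ hpos).1 (hE F (Finset.mem_univ _))
  refine hrec.mono ?_
  rcases le_or_gt a 0 with hle | hpos
  · exact hle.trans (by positivity)
  · have hm : 0 < mass μ E := (mass_nonneg μ E).lt_of_ne' fun h0 => by
      rw [ha, h0, div_zero] at hpos; exact lt_irrefl _ hpos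
    exact hC.extremal_le hC0 hrec hpos hm (div_mul_cancel₀ _ hm.ne').symm

end Main

end BiTree

theorem theorem1p2 :
    ∃ A : ℝ, 0 < A ∧ ∀ (N : ℕ) (μ : BiTree.Boundary N → ℝ≥0) (C : ℝ), 0 ≤ C →
      (BiTree.IsCarleson C μ →
        BiTree.IsREC (A * C) μ ∧ BiTree.IsHereditaryCarleson (A * C) μ) ∧
      (BiTree.IsREC C μ →
        BiTree.IsCarleson (A * C) μ ∧ BiTree.IsHereditaryCarleson (A * C) μ) ∧
      (BiTree.IsHereditaryCarleson C μ →
        BiTree.IsCarleson (A * C) μ ∧ BiTree.IsREC (A * C) μ) := by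
  refine ⟨42467328, by norm_num, fun N μ C hC => ⟨fun h => ?_, fun h => ?_, fun h => ?_⟩⟩
  · have hR := h.isREC hC
    exact ⟨hR, hR.isHereditaryCarleson⟩
  · have hR : BiTree.IsREC (42467328 * C) μ := h.mono (by linarith)
    exact ⟨hR.isCarleson, hR.isHereditaryCarleson⟩
  · have hR := h.isCarleson.isREC hC
    exact ⟨hR.isCarleson, hR⟩
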